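/- Let $k$ be a field, let $\Lambda$ be a finite dimensional $k$-algebra, and let $\operatorname{mod}\Lambda$ be the category of finitely generated right $\Lambda$-modules. A torsion pair in $\operatorname{mod}\Lambda$ is a pair $(\mathcal T,\mathcal F)$ of full subcategories, closed under isomorphism, such that $\operatorname{Hom}(T,F)=0$ for all $T\in\mathcal T$, $F\in\mathcal F$, and every $A\in\operatorname{mod}\Lambda$ admits a short exact sequence $0\to T_A\to A\to F_A\to 0$ with $T_A\in\mathcal T$ and $F_A\in\mathcal F$; then $\mathcal F$ is called a torsion free class. A module $S$ is called torsion free, almost torsion for $(\mathcal T,\mathcal F)$ if $S\neq 0$, $S\in\mathcal F$, every proper quotient of $S$ lies in $\mathcal T$, and for every short exact sequence $0\to S\to F\to C\to 0$ with $F\in\mathcal F$ one has $C\in\mathcal F$. A semibrick in $\operatorname{mod}\Lambda$ is a collection $\mathcal S$ of modules, considered up to isomorphism, each of which has a division ring as its endomorphism ring, such that $\operatorname{Hom}(S_1,S_2)=0$ for any non-isomorphic $S_1,S_2\in\mathcal S$. Lemma 3.8. Let $\mathcal S$ be a semibrick in $\operatorname{mod}\Lambda$. Then there is a smallest torsion free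 class $\tilde{\mathsf F}(\mathcal S)$ in $\operatorname{mod}\Lambda$ containing $\mathcal S$, and for the torsion pair $(\mathcal T,\tilde{\mathsf F}(\mathcal S))$ a module $X\in\operatorname{mod}\Lambda$ is torsion free, almost torsion if and only if $X$ is isomorphic to a member of $\mathcal S$. -/

import Mathlib

open CategoryTheory CategoryTheory.Limits

universe v u

section AbelianCategoryNotions

variable {C : Type u} [Category.{v} C] [Preadditive C]

/-- A torsion pair `(T, F)` of full subcategories, closed under isomorphism, of an abelian
category: there are no nonzero maps from `T` to `F`, and every object `A` is the middle term of a
short exact sequence `0 ⟶ X ⟶ A ⟶ Y ⟶ 0` with `X` in `T` and `Y` in `F`. -/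
structure IsTorsionPair (T F : ObjectProperty C) : Prop where
  isoClosed_torsion : T.IsClosedUnderIsomorphisms
  isoClosed_torsionFree : F.IsClosedUnderIsomorphisms
  hom_eq_zero : ∀ ⦃X Y : C⦄, T X → F Y → ∀ f : X ⟶ Y, f = 0
  exists_shortExact : ∀ A : C, ∃ (X Y : C) (i : X ⟶ A) (p : A ⟶ Y) (w : i ≫ p = 0),
    T X ∧ F Y ∧ (ShortComplex.mk i p w).ShortExact

/-- A torsion free class is the second component of a torsion pair. -/
def IsTorsionFreeClass (F : ObjectProperty C) : Prop :=
  ∃ T : ObjectProperty C, IsTorsionPair T F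

/-- The intersection of all torsion free classes containing `P`. It is the smallest torsion free
class containing `P` whenever it is itself a torsion free class. -/
def torsionFreeClosure (P : ObjectProperty C) : ObjectProperty C :=
  fun X => ∀ F : ObjectProperty C, IsTorsionFreeClass F → P ≤ F → F X

/-- A brick: a nonzero object all of whose nonzero endomorphisms are isomorphisms, that is, an
object whose endomorphism ring is a division ring. -/
def IsBrick (S : C) : Prop :=
  ¬ IsZero S ∧ ∀ f : S ⟶ S, f ≠ 0 → IsIso f

/-- A semibrick: a collection of bricks, objects being considered up to isomorphism, with no
nonzero maps between different (that is, non-isomorphic) members. -/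
def IsSemibrick (P : ObjectProperty C) : Prop :=
  (∀ S, P S → IsBrick S) ∧
    ∀ S₁ S₂, P S₁ → P S₂ → IsEmpty (S₁ ≅ S₂) → ∀ f : S₁ ⟶ S₂, f = 0

/-- The torsion free, almost torsion objects of a pair `(T, F)`: the nonzero objects `S` of `F`
such that every proper quotient of `S` lies in `T`, and such that for every short exact sequence
`0 ⟶ S ⟶ Y ⟶ Z ⟶ 0` with `Y` in `F`, also `Z` lies in `F`. -/
structure IsTorsionFreeAlmostTorsion (T F : ObjectProperty C) (S : C) : Prop where
  nonzero : ¬ IsZero S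
  torsionFree : F S
  proper_quotient : ∀ ⦃Q : C⦄ (q : S ⟶ Q), Epi q → ¬ IsIso q → T Q
  cokernel : ∀ ⦃Y Z : C⦄ (i : S ⟶ Y) (p : Y ⟶ Z) (w : i ≫ p = 0),
    F Y → (ShortComplex.mk i p w).ShortExact → F Z

end AbelianCategoryNotions

/-- `mod Λ`, the category of finitely generated right `Λ`-modules, as left modules over the
opposite ring. (Over a finite dimensional algebra, finitely generated is the same as finitely
presented.) -/
abbrev RightMod (Λ : Type u) [Ring Λ] := FGModuleCat.{u} Λᵐᵒᵖ

section TorsionPairs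

variable {C : Type u} [Category.{v} C]

/-! The smallest torsion free class is the double orthogonal `P.leftOrthogonal.rightOrthogonal`;
Noetherianity supplies the canonical sequences. Members of a semibrick satisfy Schur's lemma:
nonzero maps between them are isomorphisms. This yields both almost torsion conditions. Conversely,
a torsion free, almost torsion `X` embeds in some `S` in `P`, with cokernel both torsion and torsion
free, hence zero. -/

lemma IsSemibrick.isIso [Preadditive C] {P : ObjectProperty C} (hP : IsSemibrick P) {S S' : C}
    (hS : P S) (hS' : P S') (f : S ⟶ S') (hf : f ≠ 0) : IsIso f := by
  by_cases h : IsEmpty (S ≅ S')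
  · exact (hf (hP.2 S S' hS hS' h f)).elim
  · rw [not_isEmpty_iff] at h
    obtain ⟨e⟩ := h
    have : IsIso (f ≫ e.inv) := (hP.1 S hS).2 _ fun h0 ↦ hf <| by
      rw [← cancel_mono e.inv, h0, zero_comp]
    exact IsIso.of_isIso_comp_right f e.inv

variable [Abelian C]

lemma exists_comp_eq_of_kernel_ι_comp_eq_zero {X Y Z : C} (q : X ⟶ Y) [Epi q] (h : X ⟶ Z)
    (w : kernel.ι q ≫ h = 0) : ∃ l : Y ⟶ Z, q ≫ l = h :=
  ⟨(Abelian.epiIsCokernelOfKernel _ (kernelIsKernel q)).desc (CokernelCofork.ofπ h w),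
    (Abelian.epiIsCokernelOfKernel _ (kernelIsKernel q)).fac _ WalkingParallelPair.one⟩

/-- In the pullback of a cokernel diagram `U ⟶ A ⟶ Q` along `W ⟶ Q`, a map out of the pullback
that vanishes on `U` factors through `W`. -/
lemma exists_pullback_fst_comp_eq {U A Q W Z : C} {i : U ⟶ A} {p : A ⟶ Q} {w : i ≫ p = 0}
    (hs : (ShortComplex.mk i p w).ShortExact) (f : W ⟶ Q) (h : pullback f p ⟶ Z)
    (hh : pullback.lift (0 : U ⟶ W) i (by simp [w]) ≫ h = 0) :
    ∃ l : W ⟶ Z, pullback.fst f p ≫ l = h := by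
  have : Epi p := hs.epi_g
  have : Mono i := hs.mono_f
  refine exists_comp_eq_of_kernel_ι_comp_eq_zero _ h ?_
  have hk : (kernel.ι (pullback.fst f p) ≫ pullback.snd f p) ≫ p = 0 := by
    rw [Category.assoc, ← pullback.condition, kernel.condition_assoc, zero_comp]
  obtain ⟨t, ht⟩ : ∃ t, t ≫ i = kernel.ι (pullback.fst f p) ≫ pullback.snd f p :=
    ⟨hs.exact.lift _ hk, hs.exact.lift_f _ hk⟩
  have : kernel.ι (pullback.fst f p) = t ≫ pullback.lift (0 : U ⟶ W) i (by simp [w]) := by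
    apply pullback.hom_ext
    · rw [kernel.condition, Category.assoc, pullback.lift_fst, comp_zero]
    · rw [Category.assoc, pullback.lift_snd, ht]
  rw [this, Category.assoc, hh, comp_zero]

lemma IsTorsionPair.torsionFree_eq {T F : ObjectProperty C} (h : IsTorsionPair T F) :
    F = T.rightOrthogonal := by
  have := h.isoClosed_torsionFree
  ext X
  refine ⟨fun hX Y f hY ↦ h.hom_eq_zero hY hX f, fun hX ↦ ?_⟩
  obtain ⟨Y, Z, i, p, w, hY, hZ, hs⟩ := h.exists_shortExact X
  have : Mono p := hs.exact.mono_g (hX i hY)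
  have : Epi p := hs.epi_g
  have : IsIso p := isIso_of_mono_of_epi p
  exact F.prop_of_iso (asIso p).symm hZ

lemma IsTorsionPair.torsion_eq {T F : ObjectProperty C} (h : IsTorsionPair T F) :
    T = F.leftOrthogonal := by
  have := h.isoClosed_torsion
  ext X
  refine ⟨fun hX Y f hY ↦ h.hom_eq_zero hX hY f, fun hX ↦ ?_⟩
  obtain ⟨Y, Z, i, p, w, hY, hZ, hs⟩ := h.exists_shortExact X
  have : Epi i := hs.exact.epi_f (hX p hZ)
  have : Mono i := hs.mono_f
  have : IsIso i := isIso_of_mono_of_epi i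
  exact T.prop_of_iso (asIso i) hY

lemma leftOrthogonal_of_epi {P : ObjectProperty C} {X Y : C} (q : X ⟶ Y) [Epi q]
    (hX : P.leftOrthogonal X) : P.leftOrthogonal Y := fun Z f hZ ↦ by
  rw [← cancel_epi q, hX (q ≫ f) hZ, comp_zero]

/-- The pullback is an extension of `W` by `U`. -/
lemma leftOrthogonal_pullback (P : ObjectProperty C) {U A Q W : C} {i : U ⟶ A} {p : A ⟶ Q}
    {w : i ≫ p = 0} (hs : (ShortComplex.mk i p w).ShortExact) (hU : P.leftOrthogonal U)
    (hW : P.leftOrthogonal W) (f : W ⟶ Q) : P.leftOrthogonal (pullback f p) := fun Z h hZ ↦ by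
  obtain ⟨l, rfl⟩ := exists_pullback_fst_comp_eq hs f h (hU _ hZ)
  rw [hW l hZ, comp_zero]

/-- In an abelian category with Noetherian objects, the objects without nonzero maps to `P` form
the torsion part of a torsion pair. -/
lemma isTorsionPair_leftOrthogonal [∀ X : C, IsNoetherianObject X] (P : ObjectProperty C) :
    IsTorsionPair P.leftOrthogonal P.leftOrthogonal.rightOrthogonal where
  isoClosed_torsion := inferInstance
  isoClosed_torsionFree := inferInstance
  hom_eq_zero X Y hX hY f := hY f hX
  exists_shortExact A := by
    obtain ⟨U, hU, hmax⟩ := wellFounded_gt.has_min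
      {U : Subobject A | P.leftOrthogonal (U : C)} ⟨⊥, fun Y f _ ↦
        ((isZero_zero C).of_iso Subobject.botCoeIsoZero).eq_of_src _ _⟩
    have hs : (ShortComplex.mk U.arrow (cokernel.π U.arrow)
        (cokernel.condition _)).ShortExact :=
      { exact := ShortComplex.exact_cokernel _
        mono_f := inferInstanceAs (Mono U.arrow)
        epi_g := inferInstanceAs (Epi (cokernel.π U.arrow)) }
    refine ⟨_, _, _, _, _, hU, fun W f hW ↦ ?_, hs⟩
    have hE := leftOrthogonal_pullback P hs hU hW f
    set s := pullback.snd f (cokernel.π U.arrow) with hsnd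
    -- The image of the pullback in `A` is torsion and contains `U`, so maximality forces equality
    -- and `f` vanishes.
    have hV : P.leftOrthogonal (imageSubobject s : C) :=
      leftOrthogonal_of_epi (factorThruImageSubobject s) hE
    have hle : U ≤ imageSubobject s := by
      refine Subobject.le_of_comm (pullback.lift 0 U.arrow (by simp) ≫
        factorThruImageSubobject s) ?_
      rw [Category.assoc, imageSubobject_arrow_comp, pullback.lift_snd]
    have heq : U = imageSubobject s := by
      by_contra hne
      exact hmax _ hV (lt_of_le_of_ne hle hne)
    have hfac : U.Factors s := Subobject.factors_of_le s heq.ge <| by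
      have := Subobject.factors_of_factors_right (factorThruImageSubobject s)
        (Subobject.factors_self (imageSubobject s))
      rwa [imageSubobject_arrow_comp] at this
    have h0 : s ≫ cokernel.π U.arrow = 0 := by
      rw [← Subobject.factorThru_arrow U s hfac, Category.assoc, cokernel.condition, comp_zero]
    rw [← cancel_epi (pullback.fst f (cokernel.π U.arrow)), pullback.condition, ← hsnd, h0,
      comp_zero]

lemma le_rightOrthogonal_leftOrthogonal (P : ObjectProperty C) :
    P ≤ P.leftOrthogonal.rightOrthogonal := fun _ hX _ f hY ↦ hY f hX

lemma rightOrthogonal_leftOrthogonal_le {P F : ObjectProperty C} (hF : IsTorsionFreeClass F)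
    (hP : P ≤ F) : P.leftOrthogonal.rightOrthogonal ≤ F := by
  obtain ⟨T, hT⟩ := hF
  intro X hX
  rw [hT.torsionFree_eq]
  exact fun Y f hY ↦ hX f fun Z g hZ ↦ hT.hom_eq_zero hY (hP _ hZ) g

lemma torsionFreeClosure_eq [∀ X : C, IsNoetherianObject X] (P : ObjectProperty C) :
    torsionFreeClosure P = P.leftOrthogonal.rightOrthogonal := by
  ext X
  exact ⟨fun hX ↦ hX _ ⟨_, isTorsionPair_leftOrthogonal P⟩ (le_rightOrthogonal_leftOrthogonal P),
    fun hX F hF hP ↦ rightOrthogonal_leftOrthogonal_le hF hP X hX⟩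

lemma isLeast_torsionFreeClosure [∀ X : C, IsNoetherianObject X] (P : ObjectProperty C) :
    IsLeast {F : ObjectProperty C | IsTorsionFreeClass F ∧ P ≤ F} (torsionFreeClosure P) := by
  rw [torsionFreeClosure_eq]
  exact ⟨⟨⟨_, isTorsionPair_leftOrthogonal P⟩, le_rightOrthogonal_leftOrthogonal P⟩,
    fun F hF ↦ rightOrthogonal_leftOrthogonal_le hF.1 hF.2⟩

lemma leftOrthogonal_rightOrthogonal_leftOrthogonal (P : ObjectProperty C) :
    P.leftOrthogonal.rightOrthogonal.leftOrthogonal = P.leftOrthogonal := by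
  ext X
  exact ⟨fun hX Y f hY ↦ hX f (le_rightOrthogonal_leftOrthogonal P _ hY),
    fun hX Y f hY ↦ hY f hX⟩

lemma IsSemibrick.leftOrthogonal_of_proper_quotient {P : ObjectProperty C} (hP : IsSemibrick P)
    {S Q : C} (hS : P S) (q : S ⟶ Q) [Epi q] (hq : ¬ IsIso q) : P.leftOrthogonal Q := by
  intro S' f hS'
  by_contra hf
  have : IsIso (q ≫ f) := hP.isIso hS hS' _ fun h0 ↦ hf <| by
    rw [← cancel_epi q, h0, comp_zero]
  have : Mono q := mono_of_mono q f
  exact hq (isIso_of_mono_of_epi q)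

/-- The pullback of the sequence along a map `g` from a torsion `W` splits by Schur's lemma. Its `W`
summand dies in the torsion free `Y`, so `g = 0`. -/
lemma IsSemibrick.rightOrthogonal_of_shortExact {P : ObjectProperty C} (hP : IsSemibrick P)
    {S Y Z : C} (hS : P S) {i : S ⟶ Y} {p : Y ⟶ Z} {w : i ≫ p = 0}
    (hY : P.leftOrthogonal.rightOrthogonal Y) (hs : (ShortComplex.mk i p w).ShortExact) :
    P.leftOrthogonal.rightOrthogonal Z := by
  intro W g hW
  have : Mono i := hs.mono_f
  have : Epi p := hs.epi_g
  let j : S ⟶ pullback g p := pullback.lift 0 i (by simp [w])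
  have hj : j ≫ pullback.snd g p = i := pullback.lift_snd ..
  obtain ⟨S', h, hS', hh⟩ : ∃ (S' : C) (h : pullback g p ⟶ S'), P S' ∧ h ≠ 0 := by
    by_contra! hE
    have h0 : pullback.snd g p = 0 := hY _ fun S' h hS' ↦ hE S' h hS'
    refine (hP.1 S hS).1 (IsZero.of_mono_eq_zero i ?_)
    rw [← hj, h0, comp_zero]
  -- If `h` vanished on `S`, it would factor through the torsion object `W`.
  have : IsIso (j ≫ h) := hP.isIso hS hS' _ fun h0 ↦ by
    obtain ⟨l, rfl⟩ := exists_pullback_fst_comp_eq hs g h h0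
    exact hh (by rw [hW l hS', comp_zero])
  let r := h ≫ inv (j ≫ h)
  have hr : j ≫ r = 𝟙 S := by rw [← Category.assoc, IsIso.hom_inv_id]
  -- The complementary idempotent kills `S`, so it factors through `W`; `s` is the resulting
  -- section.
  obtain ⟨s, hs'⟩ := exists_pullback_fst_comp_eq hs g (𝟙 _ - r ≫ j) (by
    change j ≫ _ = 0
    rw [Preadditive.comp_sub, Category.comp_id, reassoc_of% hr, sub_self])
  have hsnd : pullback.snd g p = r ≫ i := by
    have h0 : (pullback.fst g p ≫ s) ≫ pullback.snd g p = 0 := by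
      rw [Category.assoc, hY (s ≫ pullback.snd g p) hW, comp_zero]
    rw [hs', Preadditive.sub_comp, Category.id_comp, Category.assoc, hj] at h0
    exact sub_eq_zero.1 h0
  rw [← cancel_epi (pullback.fst g p), pullback.condition, hsnd, Category.assoc, w, comp_zero,
    comp_zero]

lemma IsSemibrick.isTorsionFreeAlmostTorsion_iff {P : ObjectProperty C} (hP : IsSemibrick P)
    (X : C) :
    IsTorsionFreeAlmostTorsion P.leftOrthogonal P.leftOrthogonal.rightOrthogonal X ↔
      ∃ S : C, P S ∧ Nonempty (X ≅ S) := by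
  constructor
  · intro hX
    obtain ⟨S, f, hS, hf⟩ : ∃ (S : C) (f : X ⟶ S), P S ∧ f ≠ 0 := by
      by_contra! hE
      exact hX.nonzero ((IsZero.iff_id_eq_zero X).2 (hX.torsionFree _ fun S f hS ↦ hE S f hS))
    -- Otherwise the image of `f` is a proper quotient of `X`, hence torsion, and cannot map
    -- nontrivially to `S`.
    have hmono : Mono f := by
      by_cases hq : IsIso (factorThruImage f)
      · rw [← image.fac f]
        infer_instance
      · exact (hf (by rw [← image.fac f, hX.proper_quotient _ inferInstance hq (image.ι f) hS,
          comp_zero])).elim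
    have hs : (ShortComplex.mk f (cokernel.π f) (cokernel.condition f)).ShortExact :=
      { exact := ShortComplex.exact_cokernel _
        mono_f := hmono
        epi_g := inferInstanceAs (Epi (cokernel.π f)) }
    have hF := hX.cokernel f _ _ (le_rightOrthogonal_leftOrthogonal P _ hS) hs
    have hT : P.leftOrthogonal (cokernel f) :=
      hP.leftOrthogonal_of_proper_quotient hS (cokernel.π f) fun _ ↦ hf <| by
        rw [← cancel_mono (cokernel.π f), cokernel.condition, zero_comp]
    have : Epi f := Preadditive.epi_of_isZero_cokernel f
      ((IsZero.iff_id_eq_zero _).2 (hF _ hT))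
    have : IsIso f := isIso_of_mono_of_epi f
    exact ⟨S, hS, ⟨asIso f⟩⟩
  · rintro ⟨S, hS, ⟨e⟩⟩
    exact
      { nonzero := fun h ↦ (hP.1 S hS).1 (h.of_iso e.symm)
        torsionFree := ObjectProperty.prop_of_iso _ e.symm
          (le_rightOrthogonal_leftOrthogonal P _ hS)
        proper_quotient := fun Q q _ hq ↦
          hP.leftOrthogonal_of_proper_quotient hS (e.inv ≫ q) fun _ ↦
            hq (IsIso.of_isIso_comp_left e.inv q)
        cokernel := fun Y Z i p w hY hs ↦
          hP.rightOrthogonal_of_shortExact hS (i := e.inv ≫ i) (p := p) (w := by simp [w]) hY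
            
            (ShortComplex.shortExact_of_iso (S₁ := ShortComplex.mk i p w)
              (ShortComplex.isoMk e (Iso.refl _) (Iso.refl _)) hs) }

end TorsionPairs

/-- Taking ranges embeds subobjects strictly monotonically into submodules, where ascending chains
stabilize. -/
instance {R : Type u} [Ring R] [IsNoetherianRing R] (X : FGModuleCat.{u} R) :
    IsNoetherianObject X := by
  let φ : Subobject X → Submodule R X := fun U ↦ LinearMap.range U.arrow.hom.hom
  have hφ : StrictMono φ := by
    intro U V hUV
    have hcomp : (V.arrow.hom.hom) ∘ₗ (Subobject.ofLE U V hUV.le).hom.hom = U.arrow.hom.hom := by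
      rw [← FGModuleCat.hom_hom_comp, Subobject.ofLE_arrow]
    have hle : φ U ≤ φ V := by
      dsimp only [φ]
      rw [← hcomp]
      exact LinearMap.range_comp_le_range _ _
    refine lt_of_le_of_ne hle fun heq ↦ hUV.ne ?_
    have hinj : Function.Injective V.arrow.hom.hom :=
      (ModuleCat.mono_iff_injective _).1
        (inferInstanceAs (Mono ((forget₂ (FGModuleCat R) (ModuleCat R)).map V.arrow)))
    have hsurj : Function.Surjective (Subobject.ofLE U V hUV.le).hom.hom := by
      intro x
      obtain ⟨y, hy⟩ : V.arrow.hom.hom x ∈ φ U := heq ▸ ⟨x, rfl⟩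
      exact ⟨y, hinj (by rw [← hy, ← hcomp]; rfl)⟩
    have : Epi (Subobject.ofLE U V hUV.le) :=
      (forget₂ (FGModuleCat R) (ModuleCat R)).epi_of_epi_map
        ((ModuleCat.epi_iff_surjective _).2 hsurj)
    have : IsIso (Subobject.ofLE U V hUV.le) := isIso_of_mono_of_epi _
    refine le_antisymm hUV.le (Subobject.le_of_comm (inv (Subobject.ofLE U V hUV.le)) ?_)
    rw [IsIso.inv_comp_eq, Subobject.ofLE_arrow]
  have : IsNoetherian R X := inferInstance
  have : WellFoundedGT (Subobject X) := hφ.wellFoundedGT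
  exact ⟨this⟩

lemma isNoetherianRing_mulOpposite_of_finite (k : Type v) [Field k] (Λ : Type u) [Ring Λ]
    [Algebra k Λ] [Module.Finite k Λ] : IsNoetherianRing Λᵐᵒᵖ :=
  have : Module.Finite k Λᵐᵒᵖ := Module.Finite.equiv (MulOpposite.opLinearEquiv k)
  IsNoetherianRing.of_finite k Λᵐᵒᵖ

/-- For a semibrick `𝒮` in `mod Λ`, the smallest torsion free class containing `𝒮` exists, it
is the torsion free part of a torsion pair, and `𝒮` is, up to isomorphism, the class of all
torsion free, almost torsion modules of that torsion pair. -/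
theorem lemma3p8 {k : Type v} [Field k] {Λ : Type u} [Ring Λ] [Algebra k Λ] [Module.Finite k Λ]
    (𝒮 : ObjectProperty (RightMod Λ)) (h𝒮 : IsSemibrick 𝒮) :
    IsLeast {F : ObjectProperty (RightMod Λ) | IsTorsionFreeClass F ∧ 𝒮 ≤ F}
        (torsionFreeClosure 𝒮) ∧
      ∀ T : ObjectProperty (RightMod Λ), IsTorsionPair T (torsionFreeClosure 𝒮) →
        ∀ X : RightMod Λ,
          IsTorsionFreeAlmostTorsion T (torsionFreeClosure 𝒮) X ↔
            ∃ S : RightMod Λ, 𝒮 S ∧ Nonempty (X ≅ S) := by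
  have := isNoetherianRing_mulOpposite_of_finite k Λ
  refine ⟨isLeast_torsionFreeClosure 𝒮, fun T hT X ↦ ?_⟩
  rw [hT.torsion_eq, torsionFreeClosure_eq, leftOrthogonal_rightOrthogonal_leftOrthogonal]
  exact h𝒮.isTorsionFreeAlmostTorsion_iff X
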